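/- All graphs are finite and simple, $\overline{G}$ is the complement of $G$, $K_n$ is the complete graph on $n$ vertices, and $G^{\boxtimes N}$ is the $N$-th strong power of $G$ (distinct tuples are adjacent iff in each coordinate they are equal or adjacent). Write $G \overset{q}{\to} H$ if for some $d\ge 1$ there are complex $d\times d$ projectors (Hermitian idempotents) $E_g^h$ ($g\in V(G)$, $h\in V(H)$) with $\sum_{h} E_g^h = I_d$ for all $g$, and $E_g^hE_{g'}^{h'}=0$ whenever $\{g,g'\}\in E(G)$ and $\{h,h'\}\notin E(H)$ (including $h=h'$). Write $G\overset{*}{\to} H$ if for some $d$ there are complex $d\times d$ positive semidefinite matrices $\rho\neq 0$ and $\rho_g^h$ with $\sum_h\rho_g^h=\rho$ for all $g$, and $\rho_g^h\rho_{g'}^{h'}=0$ under the same condition. Let $$\alpha_q(G)=\max\{n : K_n\overset{q}{\to}\overline{G}\},\qquad \alpha_*(G)=\max\{n : K_n\overset{*}{\to}\overline{G}\},$$ and define the quantum and the entanglement-assisted Shannon capacities $$\Theta_q(G)=\sup_{N\ge 1}\sqrt[N]{\alpha_q(G^{\boxtimes N})},\qquad \Theta_*(G)=\sup_{N\ge 1}\sqrt[N]{\alpha_*(G^{\boxtimes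 N})}$$ (by Fekete's lemma these suprema are also the limits as $N\to\infty$). The Lovász theta function is $$\vartheta(G)=\min_{c,u}\ \max_{g\in V(G)} \frac{1}{\langle c,u_g\rangle^2},$$ over all $d$, unit vectors $c\in\mathbb{R}^d$ and families of unit vectors $u_g\in\mathbb{R}^d$ with $u_g\perp u_{g'}$ for distinct non-adjacent $g,g'$ (with $1/0=\infty$; the maximum is $0$ for the graph without vertices). For a field $\mathbb{F}$ and $d\ge1$, a $d$-representation of $G$ over $\mathbb F$ is a block matrix $M=(M_{g,g'})_{g,g'\in V(G)}$ with $d\times d$ blocks over $\mathbb{F}$, $M_{g,g}=I_d$, and $M_{g,g'}=0$ for distinct non-adjacent $g,g'$. Then $\mathcal{H}_f^{\mathbb F}(G)$ is the infimum of $\operatorname{rk}(M)/d$ over all $d\ge 1$ and all $d$-representations $M$, and $\mathcal{H}^{\mathbb F}(G)$ is the minimum of $\operatorname{rk}(M)$ over the $1$-representations $M$. Let $S$ be the Schläfli graph (the $27$ lines on a smooth cubic surface, two distinct lines being adjacent iff they are skew; it is strongly regular with parameters $(27,16,10,8)$), and $\overline{S}$ its complement. **Statement.** 1. $\Theta_q(\overline{S})\le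 \mathcal{H}_f^{\mathbb{C}}(\overline{S})\le\mathcal{H}^{\mathbb{R}}(\overline{S})\le 7<9=\vartheta(\overline{S})$. 2. The two conjectures "$\Theta_*(G)=\vartheta(G)$ for every graph $G$" and "$\Theta_q(G)=\Theta_*(G)$ for every graph $G$" are not both true. 3. In other words, there exists a graph $G$ such that $\Theta_*(G)<\vartheta(G)$ or $\Theta_q(G)<\Theta_*(G)$. -/

import Mathlib

namespace ZeroError

noncomputable section

open scoped ComplexOrder

/-! ### Strong products -/

/-- The strong product `G ⊠ H`: distinct pairs are adjacent when they are equal or adjacent in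
each coordinate. -/
def strongProd {V W : Type*} (G : SimpleGraph V) (H : SimpleGraph W) : SimpleGraph (V × W) where
  Adj x y := (x.1 = y.1 ∧ H.Adj x.2 y.2) ∨ (G.Adj x.1 y.1 ∧ H.Adj x.2 y.2) ∨
    (G.Adj x.1 y.1 ∧ x.2 = y.2)
  symm := ⟨fun x y h => by
    rcases h with ⟨h, h'⟩ | ⟨h, h'⟩ | ⟨h, h'⟩
    · exact Or.inl ⟨h.symm, h'.symm⟩
    · exact Or.inr (Or.inl ⟨h.symm, h'.symm⟩)
    · exact Or.inr (Or.inr ⟨h.symm, h'.symm⟩)⟩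
  loopless := ⟨fun x h => by
    rcases h with ⟨_, h⟩ | ⟨h, _⟩ | ⟨h, _⟩
    · exact h.ne rfl
    · exact h.ne rfl
    · exact h.ne rfl⟩

/-- The `N`-fold strong power of `G`, on the vertex set `V ^ N`: distinct tuples are adjacent when
in every coordinate they are equal or adjacent in `G`. -/
def strongPow {V : Type*} (G : SimpleGraph V) (N : ℕ) : SimpleGraph (Fin N → V) where
  Adj x y := x ≠ y ∧ ∀ i, x i = y i ∨ G.Adj (x i) (y i)
  symm := ⟨fun _ _ h => ⟨h.1.symm, fun i => (h.2 i).imp Eq.symm SimpleGraph.Adj.symm⟩⟩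
  loopless := ⟨fun _ h => h.1 rfl⟩

/-- The strong power is the iterated strong product. -/
theorem strongPow_succ_adj {V : Type*} (G : SimpleGraph V) (N : ℕ) (x y : Fin (N + 1) → V) :
    (strongPow G (N + 1)).Adj x y ↔
      (strongProd G (strongPow G N)).Adj (x 0, Fin.tail x) (y 0, Fin.tail y) := by
  have key : x = y ↔ x 0 = y 0 ∧ Fin.tail x = Fin.tail y := by
    constructor
    · rintro rfl
      exact ⟨rfl, rfl⟩
    · rintro ⟨h0, h1⟩
      rw [← Fin.cons_self_tail x, ← Fin.cons_self_tail y, h0, h1]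
  have hne : G.Adj (x 0) (y 0) → x 0 ≠ y 0 := fun h => h.ne
  have htail : Fin.tail x = Fin.tail y → ∀ i, Fin.tail x i = Fin.tail y i :=
    fun h i => congrFun h i
  simp only [strongPow, strongProd, ne_eq, key, Fin.forall_fin_succ]
  simp only [Fin.tail] at htail ⊢
  grind

/-! ### Quantum and entanglement-assisted homomorphisms -/

/-- Quantum homomorphism `G → H`: for some `d ≥ 1` there are `d × d` complex projectors `E g h`
with `∑ h, E g h = 1` for every `g`, and `E g h * E g' h' = 0` whenever `g, g'` are adjacent in `G`
and `h, h'` are not adjacent in `H` (possibly `h = h'`). -/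
def QHom {V W : Type*} [Fintype W] (G : SimpleGraph V) (H : SimpleGraph W) : Prop :=
  ∃ (d : ℕ) (E : V → W → Matrix (Fin d) (Fin d) ℂ), 1 ≤ d ∧
    (∀ g h, IsStarProjection (E g h)) ∧
    (∀ g, ∑ h, E g h = 1) ∧
    (∀ g g' h h', G.Adj g g' → ¬ H.Adj h h' → E g h * E g' h' = 0)

/-- Entanglement-assisted homomorphism `G → H`: for some `d` there are `d × d` complex positive
semidefinite matrices `ρ ≠ 0` and `R g h` with `∑ h, R g h = ρ` for every `g`, and
`R g h * R g' h' = 0` whenever `g, g'` are adjacent in `G` and `h, h'` are not adjacent in `H`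
(possibly `h = h'`). -/
def EAHom {V W : Type*} [Fintype W] (G : SimpleGraph V) (H : SimpleGraph W) : Prop :=
  ∃ (d : ℕ) (ρ : Matrix (Fin d) (Fin d) ℂ) (R : V → W → Matrix (Fin d) (Fin d) ℂ),
    ρ.PosSemidef ∧ ρ ≠ 0 ∧
    (∀ g h, (R g h).PosSemidef) ∧
    (∀ g, ∑ h, R g h = ρ) ∧
    (∀ g g' h h', G.Adj g g' → ¬ H.Adj h h' → R g h * R g' h' = 0)

/-- The quantum cohomomorphism preorder `G ≤_q H`. -/
def QLe {V W : Type*} [Fintype W] (G : SimpleGraph V) (H : SimpleGraph W) : Prop :=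
  QHom Gᶜ Hᶜ

/-- The entanglement-assisted cohomomorphism preorder `G ≤_* H`. -/
def EALe {V W : Type*} [Fintype W] (G : SimpleGraph V) (H : SimpleGraph W) : Prop :=
  EAHom Gᶜ Hᶜ

/-- The quantum independence number: the largest `n` such that the edgeless graph on `n` vertices
is below `G` in the quantum cohomomorphism preorder. -/
def alphaQ {V : Type*} [Fintype V] (G : SimpleGraph V) : ℕ :=
  sSup {n : ℕ | QLe (⊤ : SimpleGraph (Fin n))ᶜ G}

/-- The entanglement-assisted independence number. -/
def alphaStar {V : Type*} [Fintype V] (G : SimpleGraph V) : ℕ :=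
  sSup {n : ℕ | EALe (⊤ : SimpleGraph (Fin n))ᶜ G}

/-- The quantum Shannon capacity: the supremum over `N ≥ 1` of the `N`-th root of the quantum
independence number of the `N`-th strong power. -/
def ThetaQ {V : Type*} [Fintype V] (G : SimpleGraph V) : ℝ :=
  ⨆ N : ℕ+, (alphaQ (strongPow G N) : ℝ) ^ (1 / ((N : ℕ) : ℝ))

/-- The entanglement-assisted Shannon capacity. -/
def ThetaStar {V : Type*} [Fintype V] (G : SimpleGraph V) : ℝ :=
  ⨆ N : ℕ+, (alphaStar (strongPow G N) : ℝ) ^ (1 / ((N : ℕ) : ℝ))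

/-! ### The Lovász theta function -/

/-- Orthonormal representations: unit vectors, with distinct non-adjacent vertices sent to
orthogonal vectors. -/
def IsOrthonormalRep {V : Type*} (G : SimpleGraph V) {d : ℕ}
    (u : V → EuclideanSpace ℝ (Fin d)) : Prop :=
  (∀ g, ‖u g‖ = 1) ∧ ∀ g g', g ≠ g' → ¬ G.Adj g g' → inner ℝ (u g) (u g') = 0

/-- The Lovász theta function: the least value of `max_g 1 / ⟪c, u g⟫ ^ 2` over all dimensions,
unit vectors `c` and orthonormal representations `u`. A pair `(c, u)` for which some `⟪c, u g⟫`
vanishes has the value infinity and does not contribute. -/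
def lovaszTheta {V : Type*} [Fintype V] (G : SimpleGraph V) : ℝ :=
  sInf {t : ℝ | ∃ (d : ℕ) (c : EuclideanSpace ℝ (Fin d)) (u : V → EuclideanSpace ℝ (Fin d)),
    ‖c‖ = 1 ∧ IsOrthonormalRep G u ∧ (∀ g, inner ℝ c (u g) ≠ 0) ∧
    t = ⨆ g, 1 / (inner ℝ c (u g)) ^ 2}

/-! ### Haemers bounds -/

/-- `d`-representations of `G` over `F`: block matrices `M` indexed by `V × Fin d` whose diagonal
blocks are the identity and whose blocks at distinct non-adjacent vertices vanish. -/
def IsDRep {V : Type*} (G : SimpleGraph V) {F : Type*} [Field F] {d : ℕ}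
    (M : Matrix (V × Fin d) (V × Fin d) F) : Prop :=
  (∀ g, M.submatrix (fun i => (g, i)) (fun j => (g, j)) = 1) ∧
  ∀ g g', g ≠ g' → ¬ G.Adj g g' → M.submatrix (fun i => (g, i)) (fun j => (g', j)) = 0

/-- The fractional Haemers bound of `G` over `F`. -/
def fracHaemers (F : Type*) [Field F] {V : Type*} [Fintype V] (G : SimpleGraph V) : ℝ :=
  sInf {r : ℝ | ∃ (d : ℕ) (M : Matrix (V × Fin d) (V × Fin d) F),
    1 ≤ d ∧ IsDRep G M ∧ r = (M.rank : ℝ) / (d : ℝ)}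

/-- The Haemers bound of `G` over `F`: the least rank of a `1`-representation. -/
def haemers (F : Type*) [Field F] {V : Type*} [Fintype V] (G : SimpleGraph V) : ℕ :=
  sInf {r : ℕ | ∃ M : Matrix (V × Fin 1) (V × Fin 1) F, IsDRep G M ∧ r = M.rank}

/-! ### The Schläfli graph -/

/-- The 27 lines on a smooth cubic surface, in Schläfli's notation: a double six `a i`, `b i` and
the fifteen lines `c i j` with `i < j`. -/
abbrev CubicLine : Type := Fin 6 ⊕ Fin 6 ⊕ {p : Fin 6 × Fin 6 // p.1 < p.2}

/-- Incidence of distinct lines: `a i` meets `b j` iff `i ≠ j`; `a i` and `b i` meet `c j k` iff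
`i ∈ {j, k}`; `c i j` meets `c k l` iff `{i, j}` and `{k, l}` are disjoint; the `a i` are mutually
skew, as are the `b i`. -/
def Meets : CubicLine → CubicLine → Prop
  | Sum.inl _, Sum.inl _ => False
  | Sum.inl i, Sum.inr (Sum.inl j) => i ≠ j
  | Sum.inl i, Sum.inr (Sum.inr p) => i = p.1.1 ∨ i = p.1.2
  | Sum.inr (Sum.inl j), Sum.inl i => i ≠ j
  | Sum.inr (Sum.inl _), Sum.inr (Sum.inl _) => False
  | Sum.inr (Sum.inl i), Sum.inr (Sum.inr p) => i = p.1.1 ∨ i = p.1.2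
  | Sum.inr (Sum.inr p), Sum.inl i => i = p.1.1 ∨ i = p.1.2
  | Sum.inr (Sum.inr p), Sum.inr (Sum.inl i) => i = p.1.1 ∨ i = p.1.2
  | Sum.inr (Sum.inr p), Sum.inr (Sum.inr q) =>
      p.1.1 ≠ q.1.1 ∧ p.1.1 ≠ q.1.2 ∧ p.1.2 ≠ q.1.1 ∧ p.1.2 ≠ q.1.2

/-- The Schläfli graph, the strongly regular graph with parameters `(27, 16, 10, 8)`: its vertices
are the 27 lines, and two distinct lines are adjacent when they are skew. -/
def schlafliGraph : SimpleGraph CubicLine where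
  Adj x y := x ≠ y ∧ ¬ Meets x y
  symm := ⟨fun x y h => ⟨h.1.symm, fun h' => h.2 (by
    rcases x with i | i | p <;> rcases y with j | j | q <;> simp only [Meets] at h' ⊢
    all_goals first
      | exact h'
      | exact ⟨h'.1.symm, h'.2.2.1.symm, h'.2.1.symm, h'.2.2.2.symm⟩)⟩⟩
  loopless := ⟨fun _ h => h.1 rfl⟩

/-! ### The two conjectures -/

/-- The conjecture that the entanglement-assisted Shannon capacity of every finite graph is its
Lovász theta function. -/
def ThetaStarEqTheta : Prop :=
  ∀ (V : Type) [Fintype V] (G : SimpleGraph V), ThetaStar G = lovaszTheta G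

/-- The conjecture that the quantum Shannon capacity and the entanglement-assisted Shannon capacity
of every finite graph agree. -/
def ThetaQEqThetaStar : Prop :=
  ∀ (V : Type) [Fintype V] (G : SimpleGraph V), ThetaQ G = ThetaStar G

end

end ZeroError

/-! Two numbers attached to the complement of the Schläfli graph are played against each other. A
quantum independent set of size `n`, tensored into a representation `M = P * Q` with `d × d` blocks,
makes the identity of size `n * D * d` factor through dimension `D * rk M`, so `n * d ≤ rk M`
(`mul_card_le_of_QLe`). Applied to tensor powers of `M`, this bounds the quantum capacity by the
fractional Haemers bound. Minus the intersection matrix of the 27 lines is a representation of rank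
at most 7, since the Picard lattice has rank 7. On the other side, theta equals 9: an explicit
representation attains 9, and a dual one for the Schläfli graph gives the lower bound through
`sum_inner_sq_mul_le`. If both conjectures held, then 9 ≤ 7. -/

namespace ZeroError

noncomputable section

open scoped ComplexOrder

/-! ### Quantum independent sets and the rank of block representations -/

/-- A matrix of rank `r` factors through an index type with `r` elements. -/
theorem exists_rank_factorization {m n F : Type*} [Fintype m] [Fintype n] [Field F]
    (M : Matrix m n F) :
    ∃ (P : Matrix m (Fin M.rank) F) (Q : Matrix (Fin M.rank) n F), M = P * Q := by
  classical
  let b : Module.Basis (Fin M.rank) F (LinearMap.range M.mulVecLin) :=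
    Module.finBasisOfFinrankEq F _ rfl
  refine ⟨Matrix.of fun i k => (b k : m → F) i,
    Matrix.of fun k j => b.repr ⟨M.mulVecLin (Pi.single j 1), ⟨_, rfl⟩⟩ k, ?_⟩
  ext i j
  have h := congrArg (fun w : LinearMap.range M.mulVecLin => (w : m → F) i)
    (b.sum_repr ⟨M.mulVecLin (Pi.single j 1), ⟨_, rfl⟩⟩)
  simp only [Submodule.coe_sum, Submodule.coe_smul, Finset.sum_apply, Pi.smul_apply,
    smul_eq_mul, Matrix.mulVecLin_apply, Matrix.mulVec_single_one, Matrix.col_apply] at h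
  rw [Matrix.mul_apply, ← h]
  exact Finset.sum_congr rfl fun k _ => by
    simp only [Matrix.of_apply, Matrix.mulVecLin_apply, Matrix.mulVec_single_one, mul_comm]

/-- Projectors that sum to the identity are mutually orthogonal. -/
theorem mul_eq_zero_of_sum_eq_one {W : Type*} [Fintype W] {D : ℕ}
    {E : W → Matrix (Fin D) (Fin D) ℂ} (hE : ∀ h, IsStarProjection (E h)) (hs : ∑ h, E h = 1)
    {h k : W} (hk : h ≠ k) : E h * E k = 0 := by
  classical
  have hterm : ∀ j, (E j * E k).conjTranspose * (E j * E k) = E k * E j * E k := fun j => by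
    have hj : (E j).conjTranspose = E j := (hE j).isSelfAdjoint
    have hk' : (E k).conjTranspose = E k := (hE k).isSelfAdjoint
    rw [Matrix.conjTranspose_mul, hj, hk', Matrix.mul_assoc, ← Matrix.mul_assoc (E j) (E j),
      (hE j).isIdempotentElem.eq, Matrix.mul_assoc]
  have hkk : E k * E k = E k := (hE k).isIdempotentElem
  -- Compressing `∑ j, E j = 1` by `E k` gives `E k`, which the term `j = k` already supplies. The
  -- remaining terms are positive semidefinite with sum zero, so each trace vanishes.
  have hsum : ∑ j ∈ Finset.univ.erase k, (E j * E k).conjTranspose * (E j * E k) = 0 := by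
    have h1 : ∑ j, E k * E j * E k = E k := by
      rw [← Finset.sum_mul, ← Finset.mul_sum, hs, Matrix.mul_one, hkk]
    rw [← Finset.add_sum_erase _ _ (Finset.mem_univ k), hkk, hkk] at h1
    simpa only [hterm] using add_eq_left.mp h1
  have htr := congrArg Matrix.trace hsum
  rw [Matrix.trace_sum, Matrix.trace_zero, Finset.sum_eq_zero_iff_of_nonneg
    fun j _ => (Matrix.posSemidef_conjTranspose_mul_self _).trace_nonneg] at htr
  exact Matrix.trace_conjTranspose_mul_self_eq_zero_iff.mp
    (htr h (Finset.mem_erase.mpr ⟨hk, Finset.mem_univ h⟩))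

/-- If `G` is above the edgeless graph on `n` vertices in the quantum cohomomorphism preorder, then
a representation of `G` with blocks indexed by `δ` has rank at least `n * |δ|`. -/
theorem mul_card_le_of_QLe {V δ r : Type*} [Fintype V] [Fintype δ] [DecidableEq δ] [Fintype r]
    {G : SimpleGraph V} {n : ℕ} (hG : QLe (⊤ : SimpleGraph (Fin n))ᶜ G)
    (P : Matrix (V × δ) r ℂ) (Q : Matrix r (V × δ) ℂ)
    (hdiag : ∀ h i j, (P * Q) (h, i) (h, j) = if i = j then 1 else 0)
    (hzero : ∀ h h' i j, h ≠ h' → ¬ G.Adj h h' → (P * Q) (h, i) (h', j) = 0) :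
    n * Fintype.card δ ≤ Fintype.card r := by
  classical
  obtain ⟨D, E, hD, hE, hs, ho⟩ := hG
  -- The block of `X * Y` at `(g, g')` is `∑ h h', (E g h * E g' h') ⊗ (P * Q)_{h h'}`. Splitting
  -- the factors this way keeps the inner dimension at `D * |r|`.
  let X : Matrix (Fin n × Fin D × δ) (Fin D × r) ℂ :=
    Matrix.of fun x y => ∑ h, E x.1 h x.2.1 y.1 * P (h, x.2.2) y.2
  let Y : Matrix (Fin D × r) (Fin n × Fin D × δ) ℂ :=
    Matrix.of fun y x => ∑ h, Q y.2 (h, x.2.2) * E x.1 h y.1 x.2.1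
  have hXY : ∀ x x', (X * Y) x x' = ∑ h, ∑ h',
      (E x.1 h * E x'.1 h') x.2.1 x'.2.1 * (P * Q) (h, x.2.2) (h', x'.2.2) := by
    intro x x'
    simp only [Matrix.mul_apply, X, Y, Matrix.of_apply, Fintype.sum_mul_sum, Fintype.sum_prod_type]
    calc _ = ∑ b, ∑ h, ∑ h', ∑ k, (E x.1 h x.2.1 b * P (h, x.2.2) k) *
          (Q k (h', x'.2.2) * E x'.1 h' b x'.2.1) := by
          refine Finset.sum_congr rfl fun b _ => ?_
          rw [Finset.sum_comm]
          exact Finset.sum_congr rfl fun h _ => Finset.sum_comm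
      _ = _ := by
          rw [Finset.sum_comm]
          refine Finset.sum_congr rfl fun h _ => ?_
          rw [Finset.sum_comm]
          exact Finset.sum_congr rfl fun h' _ => Finset.sum_congr rfl fun b _ =>
            Finset.sum_congr rfl fun k _ => by ring
  have hone : X * Y = 1 := by
    ext ⟨g, a, i⟩ ⟨g', a', j⟩
    rw [hXY]
    by_cases hg : g = g'
    · subst hg
      have h1 : ∀ h, ∑ h', (E g h * E g h') a a' * (P * Q) (h, i) (h', j) =
          E g h a a' * if i = j then 1 else 0 := fun h => by
        rw [Finset.sum_eq_single h, (hE g h).isIdempotentElem.eq, hdiag]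
        · intro h' _ hh
          rw [mul_eq_zero_of_sum_eq_one (hE g) (hs g) hh.symm, Matrix.zero_apply, zero_mul]
        · exact fun hh => absurd (Finset.mem_univ h) hh
      simp only [h1]
      rw [← Finset.sum_mul, ← Matrix.sum_apply, hs]
      by_cases ha : a = a' <;> by_cases hi : i = j <;> simp [Matrix.one_apply, ha, hi]
    · rw [Matrix.one_apply_ne (fun h => hg (congrArg Prod.fst h))]
      refine Finset.sum_eq_zero fun h _ => Finset.sum_eq_zero fun h' _ => ?_
      -- Each term has a vanishing factor: the representation block when `h, h'` are distinct and
      -- non-adjacent in `G`, the product of projectors otherwise, including `h = h'`.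
      by_cases hh : Gᶜ.Adj h h'
      · rw [hzero h h' i j hh.1 hh.2, mul_zero]
      · rw [ho g g' h h' (by simpa using hg) hh, Matrix.zero_apply, zero_mul]
  have hrank : (X * Y).rank ≤ Fintype.card (Fin D × r) :=
    (Matrix.rank_mul_le_left X Y).trans (Matrix.rank_le_card_width X)
  rw [hone, Matrix.rank_one] at hrank
  simp only [Fintype.card_prod, Fintype.card_fin] at hrank
  exact Nat.le_of_mul_le_mul_left (by linarith [mul_left_comm n D (Fintype.card δ)]) hD

theorem IsDRep.apply_diag {V F : Type*} [Field F] {G : SimpleGraph V} {d : ℕ}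
    {M : Matrix (V × Fin d) (V × Fin d) F} (hM : IsDRep G M) (g : V) (i j : Fin d) :
    M (g, i) (g, j) = if i = j then 1 else 0 := by
  simpa [Matrix.one_apply] using congrFun (congrFun (hM.1 g) i) j

theorem IsDRep.apply_eq_zero {V F : Type*} [Field F] {G : SimpleGraph V} {d : ℕ}
    {M : Matrix (V × Fin d) (V × Fin d) F} (hM : IsDRep G M) {g g' : V} (hne : g ≠ g')
    (hadj : ¬ G.Adj g g') (i j : Fin d) : M (g, i) (g', j) = 0 :=
  congrFun (congrFun (hM.2 g g' hne hadj) i) j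

theorem isDRep_of_apply {V F : Type*} [Field F] {G : SimpleGraph V} {d : ℕ}
    {M : Matrix (V × Fin d) (V × Fin d) F}
    (hdiag : ∀ g i j, M (g, i) (g, j) = if i = j then 1 else 0)
    (hzero : ∀ g g', g ≠ g' → ¬ G.Adj g g' → ∀ i j, M (g, i) (g', j) = 0) : IsDRep G M :=
  ⟨fun g => by ext i j; simp [hdiag, Matrix.one_apply],
    fun g g' h h' => by ext i j; exact hzero g g' h h' i j⟩

/-- The tensor power of a representation of `G` is a representation of the strong power. -/
theorem alphaQ_strongPow_mul_le {V : Type*} [Fintype V] {G : SimpleGraph V} {d : ℕ}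
    {M : Matrix (V × Fin d) (V × Fin d) ℂ} (hM : IsDRep G M) (hd : 1 ≤ d) (N : ℕ) :
    alphaQ (strongPow G N) * d ^ N ≤ M.rank ^ N := by
  classical
  obtain ⟨P, Q, hPQ⟩ := exists_rank_factorization M
  have hkey : ∀ n, QLe (⊤ : SimpleGraph (Fin n))ᶜ (strongPow G N) → n * d ^ N ≤ M.rank ^ N := by
    intro n hn
    -- Tensoring the factors of `M` bounds the inner dimension by `M.rank ^ N` with no rank
    -- computation for the tensor power.
    let P' : Matrix ((Fin N → V) × (Fin N → Fin d)) (Fin N → Fin M.rank) ℂ :=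
      Matrix.of fun x k => ∏ t, P (x.1 t, x.2 t) (k t)
    let Q' : Matrix (Fin N → Fin M.rank) ((Fin N → V) × (Fin N → Fin d)) ℂ :=
      Matrix.of fun k x => ∏ t, Q (k t) (x.1 t, x.2 t)
    have hmul : ∀ x y, (P' * Q') x y = ∏ t, M (x.1 t, x.2 t) (y.1 t, y.2 t) := fun x y => by
      conv_rhs => rw [hPQ]
      simp only [Matrix.mul_apply, P', Q', Matrix.of_apply, ← Finset.prod_mul_distrib, Finset.prod_univ_sum,
        Fintype.piFinset_univ]
    have := mul_card_le_of_QLe hn P' Q' (fun h i j => by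
      simp only [hmul, hM.apply_diag]
      by_cases hij : i = j
      · simp [hij]
      · obtain ⟨t, ht⟩ := Function.ne_iff.mp hij
        rw [if_neg hij]
        exact Finset.prod_eq_zero (Finset.mem_univ t) (if_neg ht)) (fun h h' i j hne hadj => by
      obtain ⟨t, ht⟩ : ∃ t, ¬ (h t = h' t ∨ G.Adj (h t) (h' t)) := by
        by_contra! hall
        exact hadj ⟨hne, hall⟩
      rw [not_or] at ht
      rw [hmul]
      exact Finset.prod_eq_zero (Finset.mem_univ t) (hM.apply_eq_zero ht.1 ht.2 _ _))
    simpa using this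
  have hpos : 0 < d ^ N := pow_pos hd N
  refine (Nat.le_div_iff_mul_le hpos).mp (csSup_le' fun n hn => ?_)
  exact (Nat.le_div_iff_mul_le hpos).mpr (hkey n hn)

theorem isDRep_one {V F : Type*} [Field F] [DecidableEq V] (G : SimpleGraph V) (d : ℕ) :
    IsDRep G (1 : Matrix (V × Fin d) (V × Fin d) F) :=
  isDRep_of_apply (fun g i j => by simp [Matrix.one_apply])
    fun g g' h _ i j => by simp [h]

/-- The quantum Shannon capacity is at most the fractional Haemers bound over `ℂ`. -/
theorem ThetaQ_le_fracHaemers {V : Type*} [Fintype V] (G : SimpleGraph V) :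
    ThetaQ G ≤ fracHaemers ℂ G := by
  classical
  refine le_csInf ⟨_, 1, 1, le_rfl, isDRep_one G 1, rfl⟩ ?_
  rintro _ ⟨d, M, hd, hM, rfl⟩
  refine ciSup_le fun N => ?_
  have hd' : (0 : ℝ) < d := by exact_mod_cast hd
  have hN : ((N : ℕ) : ℝ) ≠ 0 := by exact_mod_cast N.ne_zero
  have h : (alphaQ (strongPow G N) : ℝ) ≤ ((M.rank : ℝ) / d) ^ (N : ℕ) := by
    rw [div_pow, le_div_iff₀ (pow_pos hd' _)]
    exact_mod_cast alphaQ_strongPow_mul_le hM hd N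
  calc (alphaQ (strongPow G N) : ℝ) ^ (1 / ((N : ℕ) : ℝ))
      ≤ (((M.rank : ℝ) / d) ^ (N : ℕ)) ^ (1 / ((N : ℕ) : ℝ)) :=
        Real.rpow_le_rpow (Nat.cast_nonneg _) h (by positivity)
    _ = (M.rank : ℝ) / d := by
        rw [one_div, Real.pow_rpow_inv_natCast (by positivity) N.ne_zero]

/-- The fractional Haemers bound over an extension field is at most the Haemers bound. -/
theorem fracHaemers_le_haemers {V F K : Type*} [Fintype V] [Field F] [Field K] (f : F →+* K)
    (G : SimpleGraph V) : fracHaemers K G ≤ (haemers F G : ℝ) := by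
  classical
  obtain ⟨M, hM, hr⟩ := Nat.sInf_mem (s := {r : ℕ | ∃ M : Matrix (V × Fin 1) (V × Fin 1) F,
    IsDRep G M ∧ r = M.rank}) ⟨_, 1, isDRep_one G 1, rfl⟩
  obtain ⟨P, Q, hPQ⟩ := exists_rank_factorization M
  have hrank : (M.map f).rank ≤ M.rank := by
    conv_lhs => rw [hPQ, Matrix.map_mul]
    exact (Matrix.rank_mul_le_left _ _).trans
      ((Matrix.rank_le_card_width _).trans_eq (Fintype.card_fin _))
  have hmap : IsDRep G (M.map f) := isDRep_of_apply
    (fun g i j => by rw [Matrix.map_apply, hM.apply_diag]; split_ifs <;> simp)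
    fun g g' h h' i j => by rw [Matrix.map_apply, hM.apply_eq_zero h h', map_zero]
  have hmem : ((M.map f).rank : ℝ) / (1 : ℕ) ∈ {r : ℝ | ∃ (d : ℕ)
      (M : Matrix (V × Fin d) (V × Fin d) K), 1 ≤ d ∧ IsDRep G M ∧ r = (M.rank : ℝ) / (d : ℝ)} :=
    ⟨1, M.map f, le_rfl, hmap, rfl⟩
  refine (csInf_le ⟨0, ?_⟩ hmem).trans ?_
  · rintro _ ⟨d, M, _, _, rfl⟩
    positivity
  · rw [haemers, hr, Nat.cast_one, div_one]
    exact_mod_cast hrank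

/-! ### The intersection form on the 27 lines -/

instance : DecidableRel Meets := fun x y => by
  rcases x with i | i | p <;> rcases y with j | j | q <;> unfold Meets <;> infer_instance

/-- The coefficients of the class of a line in the Picard group of the cubic surface, with respect
to the basis formed by the hyperplane class and minus the six exceptional classes. -/
def lineClass : CubicLine → Fin 7 → ℤ
  | Sum.inl i => Fin.cons 0 fun k => if k = i then -1 else 0
  | Sum.inr (Sum.inl i) => Fin.cons 2 fun k => if k = i then 0 else 1
  | Sum.inr (Sum.inr p) => Fin.cons 1 fun k => if k = p.1.1 ∨ k = p.1.2 then 1 else 0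

/-- The intersection number of two lines. -/
def intersection (x y : CubicLine) : ℤ :=
  ∑ k, (if k = 0 then 1 else -1) * lineClass x k * lineClass y k

/-- Lines on a cubic surface are (-1)-curves, so minus the intersection matrix has unit diagonal and
vanishes at skew pairs, as a representation requires. -/
theorem intersection_eq : ∀ x y : CubicLine,
    intersection x y = if x = y then -1 else if Meets x y then 1 else 0 := by
  decide +kernel

theorem intersection_comm (x y : CubicLine) : intersection x y = intersection y x := by
  unfold intersection
  exact Finset.sum_congr rfl fun k _ => by ring

theorem sum_intersection : ∀ x : CubicLine, ∑ z, intersection x z = 9 := by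
  decide +kernel

/-- With `A` the intersection matrix and `J` all ones this is `A² = -6A + 5J`, the strong regularity
of the meeting graph, with parameters (27,10,1,5). Hence `A` has eigenvalue 9 on constants and only
0 and -6 on their complement. -/
theorem sum_intersection_mul : ∀ x y : CubicLine,
    ∑ z, intersection x z * intersection y z = -6 * intersection x y + 5 := by
  decide +kernel

theorem card_cubicLine : Fintype.card CubicLine = 27 := by
  decide +kernel

theorem schlafliGraph_compl_adj {x y : CubicLine} :
    schlafliGraphᶜ.Adj x y ↔ x ≠ y ∧ Meets x y := by
  rw [SimpleGraph.compl_adj]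
  simp only [schlafliGraph]
  tauto

theorem intersection_self (x : CubicLine) : intersection x x = -1 := by
  rw [intersection_eq, if_pos rfl]

theorem intersection_of_meets {x y : CubicLine} (hne : x ≠ y) (h : Meets x y) :
    intersection x y = 1 := by
  rw [intersection_eq, if_neg hne, if_pos h]

theorem intersection_of_not_meets {x y : CubicLine} (hne : x ≠ y) (h : ¬ Meets x y) :
    intersection x y = 0 := by
  rw [intersection_eq, if_neg hne, if_neg h]

/-- The intersection form has rank `7`. -/
theorem haemers_schlafliGraph_compl_le : haemers ℝ schlafliGraphᶜ ≤ 7 := by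
  let P : Matrix (CubicLine × Fin 1) (Fin 7) ℝ :=
    Matrix.of fun x k => (((if k = 0 then -1 else 1) * lineClass x.1 k : ℤ) : ℝ)
  let Q : Matrix (Fin 7) (CubicLine × Fin 1) ℝ :=
    Matrix.of fun k x => (lineClass x.1 k : ℝ)
  have hmul : ∀ x y, (P * Q) x y = ((-intersection x.1 y.1 : ℤ) : ℝ) := fun x y => by
    simp only [Matrix.mul_apply, Matrix.of_apply, P, Q, intersection, ← Finset.sum_neg_distrib, Int.cast_sum]
    refine Finset.sum_congr rfl fun k _ => ?_
    split_ifs <;> push_cast <;> ring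
  have hrep : IsDRep schlafliGraphᶜ (P * Q) := isDRep_of_apply
    (fun g i j => by simp [hmul, intersection_self, Subsingleton.elim i j])
    fun g g' h h' i j => by
      rw [hmul, intersection_of_not_meets h fun hm => h' (schlafliGraph_compl_adj.mpr ⟨h, hm⟩)]
      simp
  calc haemers ℝ schlafliGraphᶜ ≤ (P * Q).rank := Nat.sInf_le ⟨P * Q, hrep, rfl⟩
    _ ≤ Fintype.card (Fin 7) :=
      (Matrix.rank_mul_le_left P Q).trans (Matrix.rank_le_card_width P)
    _ = 7 := Fintype.card_fin 7

/-! ### The Lovász theta function of the complement -/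

/-- Bessel's inequality for the tensor product of orthonormal representations of a graph and of its
complement. -/
theorem sum_inner_sq_mul_le {V E F : Type*} [Fintype V] [NormedAddCommGroup E]
    [InnerProductSpace ℝ E] [NormedAddCommGroup F] [InnerProductSpace ℝ F]
    {u : V → E} {v : V → F} (hu : ∀ g, ‖u g‖ = 1) (hv : ∀ g, ‖v g‖ = 1)
    (huv : ∀ g g', g ≠ g' → inner ℝ (u g) (u g') = 0 ∨ inner ℝ (v g) (v g') = 0) (c : E) (e : F) :
    ∑ g, inner ℝ c (u g) ^ 2 * inner ℝ e (v g) ^ 2 ≤ ‖c‖ ^ 2 * ‖e‖ ^ 2 := by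
  have horth : Orthonormal ℝ fun g => u g ⊗ₜ[ℝ] v g := by
    refine ⟨fun g => by rw [TensorProduct.norm_tmul, hu, hv, one_mul], fun g g' h => ?_⟩
    change inner ℝ (u g ⊗ₜ[ℝ] v g) (u g' ⊗ₜ[ℝ] v g') = 0
    rw [TensorProduct.inner_tmul]
    exact mul_eq_zero.mpr (huv g g' h)
  have h := horth.sum_inner_products_le (c ⊗ₜ[ℝ] e) (s := Finset.univ)
  simpa only [TensorProduct.inner_tmul, TensorProduct.norm_tmul, Real.norm_eq_abs, sq_abs, mul_pow,
    real_inner_comm] using h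

/-- The vector in `ℝ ^ (1 + V)` with first coordinate `a` and remaining coordinates `w`. -/
def consVec {V : Type*} (a : ℝ) (w : V → ℝ) : EuclideanSpace ℝ (Option V) :=
  WithLp.toLp 2 fun o => o.elim a w

theorem inner_consVec {V : Type*} [Fintype V] (a b : ℝ) (w z : V → ℝ) :
    inner ℝ (consVec a w) (consVec b z) = a * b + ∑ i, w i * z i := by
  simp [consVec, PiLp.inner_apply, Fintype.sum_option, mul_comm]

theorem sum_intersection_real (x : CubicLine) : ∑ z, (intersection x z : ℝ) = 9 := by
  exact_mod_cast sum_intersection x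

theorem sum_intersection_mul_real (x y : CubicLine) :
    ∑ z, (intersection x z : ℝ) * intersection y z = -6 * intersection x y + 5 := by
  exact_mod_cast sum_intersection_mul x y

/-- The span of `J`, `A` and the identity is closed under multiplication, by `J² = 27J`, `AJ = 9J`
and `A² = -6A + 5J`; this is the square of a general element. -/
theorem sum_affine_intersection (p q s : ℝ) (x y : CubicLine) :
    ∑ z, (p + q * intersection x z + s * if x = z then 1 else 0) *
      (p + q * intersection y z + s * if y = z then 1 else 0) =
      27 * p ^ 2 + 18 * p * q + 2 * p * s + q ^ 2 * (-6 * intersection x y + 5) +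
        2 * q * s * intersection x y + s ^ 2 * if y = x then 1 else 0 := by
  have h1 : ∀ z, (p + q * intersection x z + s * if x = z then 1 else 0) *
      (p + q * intersection y z + s * if y = z then (1 : ℝ) else 0) =
      p ^ 2 + p * q * intersection x z + p * q * intersection y z +
      q ^ 2 * (intersection x z * intersection y z) +
      (if x = z then s * (p + q * intersection y z) else 0) +
      (if y = z then s * (p + q * intersection x z) else 0) +
      (if x = z then s ^ 2 * if y = z then 1 else 0 else 0) := fun z => by
    split_ifs <;> ring
  simp only [h1, Finset.sum_add_distrib, ← Finset.mul_sum, Finset.sum_ite_eq, Finset.mem_univ,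
    if_true, sum_intersection_real, sum_intersection_mul_real, Finset.sum_const,
    Finset.card_univ, card_cubicLine, intersection_comm y x, nsmul_eq_mul]
  push_cast
  ring

/-- An optimal orthonormal representation of the complement of the Schläfli graph. -/
def schlafliComplRep (x : CubicLine) : EuclideanSpace ℝ (Option CubicLine) :=
  -- The target Gram matrix is `A/5 + 6/5`. Removing `J/9`, the share of the first coordinate,
  -- leaves `6/5` times a projection, so its rows scaled by `√(5/6)` realise it.
  consVec (1 / 3) fun z => √(5 / 6) * (-1 / 9 + 1 / 5 * intersection x z +
    6 / 5 * if x = z then 1 else 0)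

/-- An optimal orthonormal representation of the Schläfli graph. -/
def schlafliRep (x : CubicLine) : EuclideanSpace ℝ (Option CubicLine) :=
  -- Here the target is `(J - A)/2`; removing `J/3` leaves 3 times a projection. The zero
  -- coefficient only matches the shape of `sum_affine_intersection`.
  consVec √(1 / 3) fun z => √(1 / 3) * (1 / 6 + -1 / 2 * intersection x z +
    0 * if x = z then 1 else 0)

theorem inner_schlafliComplRep (x y : CubicLine) :
    inner ℝ (schlafliComplRep x) (schlafliComplRep y) =
      1 / 5 * intersection x y + 6 / 5 * if y = x then (1 : ℝ) else 0 := by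
  rw [schlafliComplRep, schlafliComplRep, inner_consVec]
  simp only [mul_mul_mul_comm √(5 / 6) _ √(5 / 6), ← Finset.mul_sum, sum_affine_intersection]
  rw [Real.mul_self_sqrt (by norm_num)]
  ring

theorem inner_schlafliRep (x y : CubicLine) :
    inner ℝ (schlafliRep x) (schlafliRep y) = 1 / 2 - 1 / 2 * (intersection x y : ℝ) := by
  rw [schlafliRep, schlafliRep, inner_consVec]
  simp only [mul_mul_mul_comm √(1 / 3) _ √(1 / 3), ← Finset.mul_sum, sum_affine_intersection]
  rw [Real.mul_self_sqrt (by norm_num)]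
  ring

theorem norm_eq_one_of_inner_self {E : Type*} [NormedAddCommGroup E] [InnerProductSpace ℝ E]
    {v : E} (h : inner ℝ v v = (1 : ℝ)) : ‖v‖ = 1 := by
  rw [norm_eq_sqrt_real_inner, h, Real.sqrt_one]

theorem norm_schlafliComplRep (x : CubicLine) : ‖schlafliComplRep x‖ = 1 :=
  norm_eq_one_of_inner_self (by rw [inner_schlafliComplRep, intersection_self]; norm_num)

theorem norm_schlafliRep (x : CubicLine) : ‖schlafliRep x‖ = 1 :=
  norm_eq_one_of_inner_self (by rw [inner_schlafliRep, intersection_self]; norm_num)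

theorem inner_schlafliComplRep_eq_zero {x y : CubicLine} (hne : x ≠ y) (h : ¬ Meets x y) :
    inner ℝ (schlafliComplRep x) (schlafliComplRep y) = 0 := by
  rw [inner_schlafliComplRep, intersection_of_not_meets hne h, if_neg hne.symm]
  norm_num

theorem inner_schlafliRep_eq_zero {x y : CubicLine} (hne : x ≠ y) (h : Meets x y) :
    inner ℝ (schlafliRep x) (schlafliRep y) = 0 := by
  rw [inner_schlafliRep, intersection_of_meets hne h]
  norm_num

/-- The first basis vector of `ℝ ^ (1 + 27)`. -/
def handle : EuclideanSpace ℝ (Option CubicLine) := consVec 1 fun _ => 0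

theorem norm_handle : ‖handle‖ = 1 :=
  norm_eq_one_of_inner_self (by rw [handle, inner_consVec]; simp)

theorem inner_handle_schlafliComplRep (x : CubicLine) :
    inner ℝ handle (schlafliComplRep x) = 1 / 3 := by
  simp [handle, schlafliComplRep, inner_consVec]

theorem inner_handle_schlafliRep_sq (x : CubicLine) :
    inner ℝ handle (schlafliRep x) ^ 2 = 1 / 3 := by
  rw [handle, schlafliRep, inner_consVec]
  simp

theorem lovaszTheta_schlafliGraph_compl : lovaszTheta schlafliGraphᶜ = 9 := by
  have : Nonempty CubicLine := ⟨Sum.inl 0⟩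
  refine IsLeast.csInf_eq ⟨?_, ?_⟩
  · let φ := LinearIsometryEquiv.piLpCongrLeft 2 ℝ ℝ (Fintype.equivFin (Option CubicLine))
    refine ⟨_, φ handle, fun x => φ (schlafliComplRep x), ?_, ⟨fun x => ?_, fun x y hne h => ?_⟩,
      fun x => ?_, ?_⟩
    · rw [φ.norm_map, norm_handle]
    · rw [φ.norm_map, norm_schlafliComplRep]
    · rw [φ.inner_map_map]
      exact inner_schlafliComplRep_eq_zero hne fun hm => h (schlafliGraph_compl_adj.mpr ⟨hne, hm⟩)
    · rw [φ.inner_map_map, inner_handle_schlafliComplRep]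
      norm_num
    · simp only [φ.inner_map_map, inner_handle_schlafliComplRep, ciSup_const]
      norm_num
  · rintro _ ⟨d, c, u, hc, ⟨hu, horth⟩, hne, rfl⟩
    have hsum := sum_inner_sq_mul_le hu norm_schlafliRep (fun g g' h => by
      by_cases hm : Meets g g'
      · exact Or.inr (inner_schlafliRep_eq_zero h hm)
      · exact Or.inl (horth g g' h fun ha => hm (schlafliGraph_compl_adj.mp ha).2)) c handle
    simp only [inner_handle_schlafliRep_sq, hc, norm_handle] at hsum
    -- The 27 values `⟪c, u g⟫ ^ 2 / 3` sum to at most 1, so some `⟪c, u g⟫ ^ 2` is at most `3 /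
    -- 27`.
    obtain ⟨g, hg⟩ : ∃ g, inner ℝ c (u g) ^ 2 ≤ 1 / 9 := by
      by_contra! hlt
      have := Finset.sum_lt_sum_of_nonempty (s := (Finset.univ : Finset CubicLine))
        Finset.univ_nonempty fun g _ => mul_lt_mul_of_pos_right (hlt g) (by norm_num : (0:ℝ) < 1 / 3)
      rw [Finset.sum_const, Finset.card_univ, card_cubicLine] at this
      norm_num at this hsum
      linarith
    calc (9 : ℝ) ≤ 1 / inner ℝ c (u g) ^ 2 := by
          rw [le_div_iff₀ (pow_pos (abs_pos.mpr (hne g)) 2 |>.trans_eq (sq_abs _))]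
          linarith
      _ ≤ _ := le_ciSup (f := fun g => 1 / inner ℝ c (u g) ^ 2) (Set.finite_range _).bddAbove g
end
end ZeroError

theorem mainTheorem10 :
    (ZeroError.ThetaQ ZeroError.schlafliGraphᶜ
        ≤ ZeroError.fracHaemers ℂ ZeroError.schlafliGraphᶜ ∧
      ZeroError.fracHaemers ℂ ZeroError.schlafliGraphᶜ
        ≤ (ZeroError.haemers ℝ ZeroError.schlafliGraphᶜ : ℝ) ∧
      (ZeroError.haemers ℝ ZeroError.schlafliGraphᶜ : ℝ) ≤ 7 ∧
      (7 : ℝ) < 9 ∧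
      ZeroError.lovaszTheta ZeroError.schlafliGraphᶜ = 9) ∧
    ¬ (ZeroError.ThetaStarEqTheta ∧ ZeroError.ThetaQEqThetaStar) ∧
    ∃ (V : Type) (_ : Fintype V) (G : SimpleGraph V),
      ZeroError.ThetaStar G < ZeroError.lovaszTheta G ∨
        ZeroError.ThetaQ G < ZeroError.ThetaStar G := by
  have h1 := ZeroError.ThetaQ_le_fracHaemers ZeroError.schlafliGraphᶜ
  have h2 := ZeroError.fracHaemers_le_haemers (algebraMap ℝ ℂ) ZeroError.schlafliGraphᶜ
  have h3 : (ZeroError.haemers ℝ ZeroError.schlafliGraphᶜ : ℝ) ≤ 7 := by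
    exact_mod_cast ZeroError.haemers_schlafliGraph_compl_le
  have h4 := ZeroError.lovaszTheta_schlafliGraph_compl
  refine ⟨⟨h1, h2, h3, by norm_num, h4⟩, fun ⟨ht, hq⟩ => ?_,
    ZeroError.CubicLine, inferInstance, ZeroError.schlafliGraphᶜ, ?_⟩
  · have ht' := ht _ ZeroError.schlafliGraphᶜ
    have hq' := hq _ ZeroError.schlafliGraphᶜ
    linarith
  -- Otherwise `9 = ϑ ≤ Θ_* ≤ Θ_q ≤ 7`.
  · by_contra! h
    linarith [h.1, h.2]
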